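/- For a finite group $G$ and a subset $S\subseteq G$ with $S^{-1}=S$ and $1\notin S$, let $\mathrm{Cay}(G,S)$ be the graph with vertex set $G$ and edge set $\{\{g,sg\}: g\in G,\ s\in S\}$. A finite graph is called integral if all eigenvalues of its adjacency matrix are integers. A finite group $G$ is called Cayley integral if $\mathrm{Cay}(G,S)$ is integral for every such $S$, and $G$ belongs to the class $\mathcal{G}_4$ if $\mathrm{Cay}(G,S)$ is integral for every such $S$ with $|S|\le 4$. Let $G$ be a finite nilpotent group. If $G\in\mathcal{G}_4$, then $G$ is Cayley integral. -/

import Mathlib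

/-- The Cayley graph `Cay(G, S)` of a group `G` with respect to a symmetric subset `S` not containing
the identity: the vertex set is `G` and the edges are the pairs `{g, s * g}` with `s ∈ S`. -/
def cayleyGraph {G : Type*} [Group G] (S : Set G) (hinv : S⁻¹ = S) (hone : (1 : G) ∉ S) :
    SimpleGraph G where
  Adj g h := ∃ s ∈ S, h = s * g
  symm := ⟨by
    rintro g h ⟨s, hs, rfl⟩
    refine ⟨s⁻¹, ?_, by group⟩
    rw [← hinv]
    exact Set.inv_mem_inv.mpr hs⟩
  loopless := ⟨by
    rintro g ⟨s, hs, h⟩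
    have h1 : s = 1 := by simpa using h
    exact hone (h1 ▸ hs)⟩

open Classical in
/-- A finite graph is integral if every (complex) eigenvalue of its adjacency matrix is an
integer. -/
def IsIntegralGraph {V : Type*} [Fintype V] (Γ : SimpleGraph V) : Prop :=
  ∀ μ : ℂ, Module.End.HasEigenvalue (Γ.adjMatrix ℂ).mulVecLin μ → ∃ z : ℤ, μ = (z : ℂ)

/-- A finite group is Cayley integral if all its Cayley graphs are integral. -/
def IsCayleyIntegral (G : Type*) [Group G] [Fintype G] : Prop :=
  ∀ (S : Set G) (hinv : S⁻¹ = S) (hone : (1 : G) ∉ S),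
    IsIntegralGraph (cayleyGraph S hinv hone)

/-- Membership of a finite group in the class `𝒢ₖ`: all Cayley graphs `Cay(G, S)` with `|S| ≤ k`
are integral. -/
def MemClassG (k : ℕ) (G : Type*) [Group G] [Fintype G] : Prop :=
  ∀ (S : Set G) (hinv : S⁻¹ = S) (hone : (1 : G) ∉ S), S.ncard ≤ k →
    IsIntegralGraph (cayleyGraph S hinv hone)

/-!
The adjacency operator of `Cay(G, S)` on functions `G → ℂ` is `∑ s ∈ S, ρ s`, where `ρ` is the left
regular representation (`adjMatrix_cayleyGraph_mulVecLin`). The proof passes through the following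
condition on `G`: every `x` satisfies `x ^ 4 = 1` or `x ^ 6 = 1`, and every conjugate of `x` is `x`
or `x⁻¹`. (For nilpotent groups it singles out the abelian groups of exponent dividing `4` or `6`
and the groups `Q₈ × C₂ⁿ`, but no classification is needed.)

The condition is sufficient (`isCayleyIntegral_of_conj`): the elements `ρ s + ρ s⁻¹` are then
central in the image of the group algebra, and each has integer eigenvalues since `s` has order
`1, 2, 3, 4` or `6`. A sum of commuting operators with integer eigenvalues has integer eigenvalues,
and the adjacency operator is such a sum.

The condition is necessary for a nilpotent group in `𝒢₄`. The cycles given by `S = {x, x⁻¹}` bound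
the orders of elements (`MemClassG.pow_four_or_pow_six`). For the rest, each configuration of
elements to be excluded gives a set `S` of at most four elements, with adjacency operator `T`, and
an element `P` of the group algebra such that `(T - c) ^ 2 * P = n * P` with `n` not a square. If
`P ≠ 0`, then `c + √n` or `c - √n` is an eigenvalue of `T`, a contradiction; and `P ≠ 0` is checked
on its coefficient at the identity. In exponent `4` this shows that involutions commute (`n = 2`),
that they are central (`n = 5`), and that non-commuting `x`, `y` satisfy `y * x = x⁻¹ * y`
(`n = 8`); nilpotency plays no role there. If there is an element of order `3`, nilpotency excludes
elements of order `4`, so the exponent divides `6`. A non-central element of the second centre would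
then give a Heisenberg group of order `27` (`c = 1`, `n = 3`) or a pair of non-commuting
involutions, so `G` is abelian.
-/

/-! ### Identities in noncommutative rings -/

section RingIdentities

variable {R : Type*} [Ring R]

/-- In a dihedral group of order `8`, where `A` and `B` are reflections and `A * B` is a rotation,
this is the identity behind the eigenvalue `√2` of an `8`-cycle. -/
theorem sq_add_mul_of_involutions {A B : R} (hA : A * A = 1) (hB : B * B = 1)
    (hAB : (A * B) ^ 4 = 1) :
    (A + B) ^ 2 * (1 - (A * B) ^ 2) = 2 * (1 - (A * B) ^ 2) := by
  have hBA : B * A = (A * B) ^ 3 := by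
    calc B * A = B * A * (A * B) ^ 4 := by rw [hAB, mul_one]
      _ = B * (A * A) * B * (A * B) ^ 3 := by noncomm_ring
      _ = (A * B) ^ 3 := by rw [hA, mul_one, hB, one_mul]
  have h : (A + B) ^ 2 = 2 + A * B + (A * B) ^ 3 := by
    calc (A + B) ^ 2 = A * A + B * B + A * B + B * A := by noncomm_ring
      _ = _ := by rw [hA, hB, hBA, one_add_one_eq_two]
  rw [h]
  generalize A * B = C at *
  calc (2 + C + C ^ 3) * (1 - C ^ 2) = 2 * (1 - C ^ 2) + C * (1 - C ^ 4) := by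
        rw [← one_add_one_eq_two]; noncomm_ring
    _ = _ := by rw [hAB, sub_self, mul_zero, add_zero]

/-- Where `Z = -1` and `B ^ 2 = 1`, the factor on the right being a multiple of the projection onto
that part, `A` and `B` anticommute and `B ^ 3 = B`, so `(A + 2 * B) ^ 2 = 1 + 4 = 5`. -/
theorem sq_add_mul_of_anticommute_five {A B Z : R} (hA : A * A = 1) (hB : B ^ 4 = 1)
    (hZ : Z * Z = 1) (hZA : A * Z = Z * A) (hZB : B * Z = Z * B) (hBA : B * A = Z * (A * B)) :
    (A + B + B ^ 3) ^ 2 * ((1 - Z) * (1 + B ^ 2)) = 5 * ((1 - Z) * (1 + B ^ 2)) := by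
  have hB' : B * (B * (B * B)) = 1 := by rw [← hB]; noncomm_ring
  have z1 (w : R) : Z * (Z * w) = w := by rw [← mul_assoc, hZ, one_mul]
  have za (w : R) : A * (Z * w) = Z * (A * w) := by rw [← mul_assoc, hZA, mul_assoc]
  have zb (w : R) : B * (Z * w) = Z * (B * w) := by rw [← mul_assoc, hZB, mul_assoc]
  have ba (w : R) : B * (A * w) = Z * (A * (B * w)) := by
    rw [← mul_assoc, hBA, mul_assoc, mul_assoc]
  simp only [pow_succ, pow_zero, one_mul, mul_add, add_mul, mul_sub, sub_mul, mul_one, mul_assoc,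
    hA, hB', hZB, hBA, z1, za, zb, ba]
  have h5 : (5 : R) = 1 + 1 + 1 + 1 + 1 := by norm_num
  rw [h5]
  noncomm_ring

/-- Where `Z = -1` and `X ^ 2 = Y ^ 2 = 1`, the factor on the right being a multiple of the
projection onto that part, `X` and `Y` anticommute, `X ^ 3 = X` and `Y ^ 3 = Y`, so
`(2 * X + 2 * Y) ^ 2 = 4 + 4 = 8`. -/
theorem sq_add_mul_of_anticommute_eight {X Y Z : R} (hX : X ^ 4 = 1) (hY : Y ^ 4 = 1)
    (hZ : Z * Z = 1) (hZX : X * Z = Z * X) (hZY : Y * Z = Z * Y) (hYX : Y * X = Z * (X * Y)) :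
    (X + X ^ 3 + Y + Y ^ 3) ^ 2 * ((1 - Z) * ((1 + X ^ 2) * (1 + Y ^ 2))) =
      8 * ((1 - Z) * ((1 + X ^ 2) * (1 + Y ^ 2))) := by
  have hX' : X * (X * (X * X)) = 1 := by rw [← hX]; noncomm_ring
  have hY' : Y * (Y * (Y * Y)) = 1 := by rw [← hY]; noncomm_ring
  have x1 (w : R) : X * (X * (X * (X * w))) = w := by
    simpa only [mul_assoc, one_mul] using congrArg (· * w) hX'
  have z1 (w : R) : Z * (Z * w) = w := by rw [← mul_assoc, hZ, one_mul]
  have zx (w : R) : X * (Z * w) = Z * (X * w) := by rw [← mul_assoc, hZX, mul_assoc]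
  have zy (w : R) : Y * (Z * w) = Z * (Y * w) := by rw [← mul_assoc, hZY, mul_assoc]
  have yx (w : R) : Y * (X * w) = Z * (X * (Y * w)) := by
    rw [← mul_assoc, hYX, mul_assoc, mul_assoc]
  simp only [pow_succ, pow_zero, one_mul, mul_add, add_mul, mul_sub, sub_mul, mul_one, mul_assoc,
    hX', hY', hZX, hZY, hYX, x1, z1, zx, zy, yx]
  have h8 : (8 : R) = 1 + 1 + 1 + 1 + 1 + 1 + 1 + 1 := by norm_num
  rw [h8]
  noncomm_ring

/-- In a faithful three-dimensional representation of the Heisenberg group of order `27`, the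
operator `X + X⁻¹ + Y + Y⁻¹` preserves the plane spanned by a `Y`-fixed vector `a` and
`(X + X⁻¹) a`, and has eigenvalues `1 ± √3` there. -/
theorem sq_sub_one_mul_of_heisenberg {X Y Z : R} (hX : X ^ 3 = 1) (hY : Y ^ 3 = 1)
    (hZ : Z ^ 3 = 1) (hZX : X * Z = Z * X) (hZY : Y * Z = Z * Y) (hYX : Y * X = Z * (X * Y)) :
    (X + X ^ 2 + Y + Y ^ 2 - 1) ^ 2 * ((1 - Z) * (1 + Y + Y ^ 2)) =
      3 * ((1 - Z) * (1 + Y + Y ^ 2)) := by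
  have hX' : X * (X * X) = 1 := by rw [← hX]; noncomm_ring
  have hY' : Y * (Y * Y) = 1 := by rw [← hY]; noncomm_ring
  have hZ' : Z * (Z * Z) = 1 := by rw [← hZ]; noncomm_ring
  have z1 (w : R) : Z * (Z * (Z * w)) = w := by
    simpa only [mul_assoc, one_mul] using congrArg (· * w) hZ'
  have zx (w : R) : X * (Z * w) = Z * (X * w) := by rw [← mul_assoc, hZX, mul_assoc]
  have zy (w : R) : Y * (Z * w) = Z * (Y * w) := by rw [← mul_assoc, hZY, mul_assoc]
  have yx (w : R) : Y * (X * w) = Z * (X * (Y * w)) := by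
    rw [← mul_assoc, hYX, mul_assoc, mul_assoc]
  simp only [pow_succ, pow_zero, one_mul, mul_add, add_mul, mul_sub, sub_mul, mul_one, mul_assoc,
    hX', hY', hZX, hZY, hYX, z1, zx, zy, yx]
  have h3 : (3 : R) = 1 + 1 + 1 := by norm_num
  rw [h3]
  noncomm_ring

/-- The eigenvalues of `X + X⁻¹` for `X ^ 4 = 1` are among `0, ±2`. -/
theorem add_cube_pow_of_pow_four {X : R} (hX : X ^ 4 = 1) :
    (X + X ^ 3) ^ 3 = 4 * (X + X ^ 3) := by
  calc (X + X ^ 3) ^ 3 = X * X ^ 4 * X ^ 4 + 3 * (X ^ 3 * X ^ 4) + 3 * (X * X ^ 4) + X ^ 3 := by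
        noncomm_ring
    _ = _ := by rw [hX]; noncomm_ring

/-- The eigenvalues of `X + X⁻¹` for `X ^ 6 = 1` are among `±1, ±2`. -/
theorem add_pow_five_pow_of_pow_six {X : R} (hX : X ^ 6 = 1) :
    (X + X ^ 5) ^ 4 = 5 * (X + X ^ 5) ^ 2 - 4 := by
  have h4 : (X + X ^ 5) ^ 4 =
      X ^ 4 + 4 * (X ^ 2 * X ^ 6) + 6 * (X ^ 6 * X ^ 6) + 4 * (X ^ 4 * X ^ 6 * X ^ 6) +
        X ^ 2 * X ^ 6 * X ^ 6 * X ^ 6 := by noncomm_ring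
  have h2 : (X + X ^ 5) ^ 2 = X ^ 2 + 2 * X ^ 6 + X ^ 4 * X ^ 6 := by noncomm_ring
  have hn : (4 : R) = 1 + 1 + 1 + 1 := by norm_num
  rw [h4, h2, hX, hn]
  noncomm_ring

end RingIdentities

/-! ### The left regular representation -/

/-- The left regular representation of `G` on complex functions on `G`: `g` sends `f` to
`h ↦ f (g⁻¹ * h)`, so that the basis function at `h` is sent to the one at `g * h`. -/
def leftTranslation (G : Type*) [Group G] : G →* Module.End ℂ (G → ℂ) where
  toFun g := LinearMap.funLeft ℂ ℂ (g⁻¹ * ·)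
  map_one' := by ext; simp [LinearMap.funLeft_apply]
  map_mul' a b := by
    ext
    simp [LinearMap.funLeft_apply, mul_assoc]

section
variable {G : Type*} [Group G]

theorem leftTranslation_apply (g h : G) (f : G → ℂ) : leftTranslation G g f h = f (g⁻¹ * h) := rfl

open Classical in
theorem leftTranslation_single_apply_one (g : G) :
    leftTranslation G g (Pi.single 1 1) 1 = if g = 1 then 1 else 0 := by
  simp [leftTranslation_apply, Pi.single_apply]

/-! ### Operators with integer eigenvalues -/

/-- All eigenvalues of the complex linear operator `T` are (rational) integers. -/
def HasIntegerEigenvalues {V : Type*} [AddCommGroup V] [Module ℂ V] (T : Module.End ℂ V) : Prop :=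
  ∀ μ : ℂ, T.HasEigenvalue μ → ∃ z : ℤ, μ = z

namespace HasIntegerEigenvalues

variable {V : Type*} [AddCommGroup V] [Module ℂ V]

theorem exists_int {T : Module.End ℂ V} (hT : HasIntegerEigenvalues T) {μ : ℂ} {v : V}
    (hv : v ≠ 0) (h : T v = μ • v) : ∃ z : ℤ, μ = z :=
  hT μ (Module.End.hasEigenvalue_of_hasEigenvector ⟨Module.End.mem_eigenspace_iff.mpr h, hv⟩)

/-- A square root `r` of `n` satisfies `(T - c - r) (T - c + r) v = 0`, so `c + r` or `c - r` is an
eigenvalue. -/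
theorem isSquare_of_sq_apply {T : Module.End ℂ V} (hT : HasIntegerEigenvalues T) (c n : ℤ)
    {v : V} (hv : v ≠ 0) (h : ((T - (c : Module.End ℂ V)) ^ 2) v = (n : ℂ) • v) : IsSquare n := by
  obtain ⟨r, hr⟩ := IsAlgClosed.exists_pow_nat_eq (n : ℂ) (n := 2) (by norm_num)
  have key : ∃ z : ℤ, ∃ s : ℂ, s ^ 2 = n ∧ (c : ℂ) + s = z := by
    have hc : ∀ w : V, (c : Module.End ℂ V) w = (c : ℂ) • w := fun w => by
      rw [Module.End.intCast_apply, Int.cast_smul_eq_zsmul]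
    set w : V := (T - (c : Module.End ℂ V)) v + r • v with hw
    have h' : (T - (c : Module.End ℂ V)) ((T - (c : Module.End ℂ V)) v) = (n : ℂ) • v := by
      rw [← h, pow_two]; rfl
    by_cases hw0 : w = 0
    · obtain ⟨z, hz⟩ := hT.exists_int (μ := c + -r) hv (by
        have : T v - (c : ℂ) • v + r • v = 0 := by
          rw [← hw0, hw, LinearMap.sub_apply, hc]
        rw [add_smul, neg_smul, ← sub_eq_zero, ← this]
        abel)
      exact ⟨z, -r, by rw [neg_sq, hr], hz⟩
    · obtain ⟨z, hz⟩ := hT.exists_int (μ := c + r) hw0 (by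
        have : (T - (c : Module.End ℂ V)) w = r • w := by
          rw [hw, map_add, h', map_smul, smul_add, smul_smul, ← hr, pow_two, add_comm]
        rw [LinearMap.sub_apply, hc, sub_eq_iff_eq_add] at this
        rw [this, add_smul, add_comm])
      exact ⟨z, r, hr, hz⟩
  obtain ⟨z, s, hs, hz⟩ := key
  refine ⟨z - c, ?_⟩
  have : s = z - c := by rw [← hz]; ring
  rw [this] at hs
  have h2 : ((n : ℤ) : ℂ) = (((z - c) * (z - c) : ℤ) : ℂ) := by rw [← hs]; push_cast; ring
  exact_mod_cast h2

theorem isSquare_of_sq_mul {T P : Module.End ℂ V} (hT : HasIntegerEigenvalues T) (c n : ℤ)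
    (h : (T - (c : Module.End ℂ V)) ^ 2 * P = (n : Module.End ℂ V) * P) {v : V} (hv : P v ≠ 0) :
    IsSquare n := by
  refine hT.isSquare_of_sq_apply c n hv ?_
  rw [← Module.End.mul_apply, h, Module.End.mul_apply, Module.End.intCast_apply,
    Int.cast_smul_eq_zsmul]

/-- The eigenspace of `S + T` is invariant under `S`, hence contains a common eigenvector of `S` and
`T`. -/
theorem add_of_commute [FiniteDimensional ℂ V] {S T : Module.End ℂ V}
    (hS : HasIntegerEigenvalues S) (hT : HasIntegerEigenvalues T) (h : Commute S T) :
    HasIntegerEigenvalues (S + T) := by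
  intro μ hμ
  have hmaps : Set.MapsTo S ((S + T).eigenspace μ) ((S + T).eigenspace μ) :=
    Module.End.mapsTo_genEigenspace_of_comm
      ((Commute.refl S).add_left h.symm) μ 1
  have : Nontrivial ((S + T).eigenspace μ) := Submodule.nontrivial_iff_ne_bot.mpr hμ
  obtain ⟨s, hs⟩ := Module.End.exists_eigenvalue (S.restrict hmaps)
  obtain ⟨⟨w, hwE⟩, hw, hw0⟩ := hs.exists_hasEigenvector
  have hw0' : w ≠ 0 := fun h => hw0 (Subtype.ext h)
  have hSw : S w = s • w := congrArg Subtype.val (Module.End.mem_eigenspace_iff.mp hw)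
  have hTw : T w = (μ - s) • w := by
    have := Module.End.mem_eigenspace_iff.mp hwE
    rw [LinearMap.add_apply, hSw] at this
    rw [sub_smul, ← this, add_sub_cancel_left]
  obtain ⟨a, ha⟩ := hS.exists_int hw0' hSw
  obtain ⟨b, hb⟩ := hT.exists_int hw0' hTw
  exact ⟨a + b, by push_cast; rw [← ha, ← hb]; ring⟩

end HasIntegerEigenvalues

/-! ### The adjacency operator of a Cayley graph -/

section Adj
variable [Fintype G]

open Classical in
theorem adjMatrix_cayleyGraph_mulVecLin (S : Finset G) (hinv : (S : Set G)⁻¹ = S)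
    (hone : (1 : G) ∉ (S : Set G)) :
    ((cayleyGraph (S : Set G) hinv hone).adjMatrix ℂ).mulVecLin = ∑ s ∈ S, leftTranslation G s := by
  have hS : ∀ s, s⁻¹ ∈ S ↔ s ∈ S := fun s => by
    rw [← Finset.mem_coe, ← Finset.mem_coe (s := S), ← Set.mem_inv, hinv]
  refine LinearMap.ext fun f => funext fun g => ?_
  rw [Matrix.mulVecLin_apply, SimpleGraph.adjMatrix_mulVec_apply, LinearMap.sum_apply,
    Finset.sum_apply]
  refine Finset.sum_bij' (fun h _ => g * h⁻¹) (fun s _ => s⁻¹ * g) ?_ ?_ ?_ ?_ ?_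
  · intro h hh
    obtain ⟨s, hs, rfl⟩ := (SimpleGraph.mem_neighborFinset _ _ _).mp hh
    simpa [hS] using hs
  · intro s hs
    exact (SimpleGraph.mem_neighborFinset _ _ _).mpr ⟨s⁻¹, (hS s).mpr hs, rfl⟩
  · simp
  · simp
  · simp [leftTranslation_apply]

theorem MemClassG.hasIntegerEigenvalues {k : ℕ} (hG : MemClassG k G) (S : Finset G)
    (hinv : ∀ s ∈ S, s⁻¹ ∈ S) (hone : (1 : G) ∉ S) (hcard : S.card ≤ k) :
    HasIntegerEigenvalues (∑ s ∈ S, leftTranslation G s) := by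
  have hinv' : (S : Set G)⁻¹ = S := by
    ext s
    exact ⟨fun h => by simpa using hinv _ h, fun h => hinv _ h⟩
  have := hG S hinv' (by simpa using hone) (by simpa using hcard)
  rw [IsIntegralGraph, adjMatrix_cayleyGraph_mulVecLin] at this
  exact this

end Adj

/-! ### A sufficient condition for Cayley integrality -/

section Converse

theorem hasIntegerEigenvalues_leftTranslation {s : G} (hs : s * s = 1) :
    HasIntegerEigenvalues (leftTranslation G s) := by
  intro μ hμ
  obtain ⟨v, hv⟩ := hμ.exists_hasEigenvector
  have h := hv.pow_apply 2
  rw [pow_two, ← map_mul, hs, map_one, Module.End.one_apply] at h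
  have : (μ ^ 2 - 1) • v = 0 := by rw [sub_smul, one_smul, ← h, sub_self]
  have h1 := sub_eq_zero.mp ((smul_eq_zero.mp this).resolve_right hv.2)
  rcases eq_or_eq_neg_of_sq_eq_sq μ 1 (by rw [h1, one_pow]) with h | h
  · exact ⟨1, by simp [h]⟩
  · exact ⟨-1, by simp [h]⟩

theorem hasIntegerEigenvalues_leftTranslation_add_inv {s : G} (hs : s ^ 4 = 1 ∨ s ^ 6 = 1) :
    HasIntegerEigenvalues (leftTranslation G s + leftTranslation G s⁻¹) := by
  intro μ hμ
  obtain ⟨v, hv⟩ := hμ.exists_hasEigenvector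
  rcases hs with hs | hs
  · have hinv : s⁻¹ = s ^ 3 := inv_eq_of_mul_eq_one_right (by rw [← pow_succ', hs])
    rw [hinv, map_pow] at hv
    have h := hv.pow_apply 3
    rw [add_cube_pow_of_pow_four (by rw [← map_pow, hs, map_one])] at h
    have h4 : (4 : Module.End ℂ (G → ℂ)) = (4 : ℂ) • 1 := by
      ext; simp
    rw [h4, smul_one_mul, LinearMap.smul_apply, hv.apply_eq_smul, smul_smul] at h
    have : (μ ^ 3 - 4 * μ) • v = 0 := by rw [sub_smul, ← h, sub_self]
    have h0 := (smul_eq_zero.mp this).resolve_right hv.2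
    have : μ * ((μ - 2) * (μ + 2)) = 0 := by linear_combination h0
    rcases mul_eq_zero.mp this with h | h
    · exact ⟨0, by simp [h]⟩
    rcases mul_eq_zero.mp h with h | h
    · exact ⟨2, by push_cast; linear_combination h⟩
    · exact ⟨-2, by push_cast; linear_combination h⟩
  · have hinv : s⁻¹ = s ^ 5 := inv_eq_of_mul_eq_one_right (by rw [← pow_succ', hs])
    rw [hinv, map_pow] at hv
    have h := hv.pow_apply 4
    rw [add_pow_five_pow_of_pow_six (by rw [← map_pow, hs, map_one])] at h
    have h4 : (4 : Module.End ℂ (G → ℂ)) = (4 : ℂ) • 1 := by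
      ext; simp
    have h5 : (5 : Module.End ℂ (G → ℂ)) = (5 : ℂ) • 1 := by
      ext; simp
    rw [h4, h5, smul_one_mul, LinearMap.sub_apply, LinearMap.smul_apply, hv.pow_apply,
      LinearMap.smul_apply, Module.End.one_apply, smul_smul, ← sub_smul] at h
    have : (μ ^ 4 - (5 * μ ^ 2 - 4)) • v = 0 := by rw [sub_smul, ← h, sub_self]
    have h0 := (smul_eq_zero.mp this).resolve_right hv.2
    have : ((μ - 1) * (μ + 1)) * ((μ - 2) * (μ + 2)) = 0 := by linear_combination h0
    rcases mul_eq_zero.mp this with h | h <;> rcases mul_eq_zero.mp h with h | h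
    · exact ⟨1, by push_cast; linear_combination h⟩
    · exact ⟨-1, by push_cast; linear_combination h⟩
    · exact ⟨2, by push_cast; linear_combination h⟩
    · exact ⟨-2, by push_cast; linear_combination h⟩

/-- Induction on `S`, removing a pair `s, s⁻¹` at each step: by `hconj` the operator of such a pair
is central. -/
theorem hasIntegerEigenvalues_sum_leftTranslation [Fintype G]
    (hpow : ∀ x : G, x ^ 4 = 1 ∨ x ^ 6 = 1)
    (hconj : ∀ g x : G, g * x = x * g ∨ g * x = x⁻¹ * g) (S : Finset G)
    (hinv : ∀ s ∈ S, s⁻¹ ∈ S) : HasIntegerEigenvalues (∑ s ∈ S, leftTranslation G s) := by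
  classical
  induction S using Finset.strongInduction with
  | H S ih =>
  rcases S.eq_empty_or_nonempty with rfl | ⟨s, hs⟩
  · intro μ hμ
    obtain ⟨v, hv⟩ := hμ.exists_hasEigenvector
    have h := hv.apply_eq_smul
    rw [Finset.sum_empty, LinearMap.zero_apply] at h
    exact ⟨0, by simpa using (smul_eq_zero.mp h.symm).resolve_right hv.2⟩
  have hsub : ({s, s⁻¹} : Finset G) ⊆ S := by
    simp [Finset.insert_subset_iff, hs, hinv s hs]
  rw [← Finset.sum_sdiff hsub]
  refine HasIntegerEigenvalues.add_of_commute (ih _ (Finset.sdiff_ssubset hsub ⟨s, by simp⟩) ?_)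
    ?_ ?_
  · intro t ht
    simp only [Finset.mem_sdiff, Finset.mem_insert, Finset.mem_singleton, not_or] at ht ⊢
    exact ⟨hinv t ht.1, fun h => ht.2.2 (by rw [← h, inv_inv]), fun h => ht.2.1 (inv_injective h)⟩
  · by_cases h : s = s⁻¹
    · rw [← h, Finset.pair_eq_singleton, Finset.sum_singleton]
      exact hasIntegerEigenvalues_leftTranslation (by nth_rw 2 [h]; simp)
    · rw [Finset.sum_pair h]
      exact hasIntegerEigenvalues_leftTranslation_add_inv (hpow s)
  · refine Commute.sum_left _ _ _ fun g _ => ?_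
    by_cases h : s = s⁻¹
    · rw [← h, Finset.pair_eq_singleton, Finset.sum_singleton]
      have : g * s = s * g := by simpa [← h] using hconj g s
      rw [commute_iff_eq, ← map_mul, ← map_mul, this]
    · rw [Finset.sum_pair h, commute_iff_eq, mul_add, add_mul]
      simp only [← map_mul]
      rcases hconj g s with h1 | h1
      · have h2 : g * s⁻¹ = s⁻¹ * g := by
          rw [eq_inv_mul_iff_mul_eq, ← mul_assoc, ← h1, mul_inv_cancel_right]
        rw [h1, h2]
      · have h2 : g * s⁻¹ = s * g := by
          rw [mul_inv_eq_iff_eq_mul, mul_assoc, h1, mul_inv_cancel_left]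
        rw [h1, h2, add_comm]

/-- A finite group in which `x ^ 4 = 1` or `x ^ 6 = 1` for all `x` and every conjugate of `x` is `x`
or `x⁻¹` is Cayley integral. -/
theorem isCayleyIntegral_of_conj [Fintype G] (hpow : ∀ x : G, x ^ 4 = 1 ∨ x ^ 6 = 1)
    (hconj : ∀ g x : G, g * x = x * g ∨ g * x = x⁻¹ * g) : IsCayleyIntegral G := by
  classical
  intro S hinv hone
  obtain ⟨S, rfl⟩ : ∃ T : Finset G, (T : Set G) = S := ⟨S.toFinset, by simp⟩
  rw [IsIntegralGraph, adjMatrix_cayleyGraph_mulVecLin]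
  refine hasIntegerEigenvalues_sum_leftTranslation hpow hconj S fun s hs => ?_
  rw [← Finset.mem_coe, ← hinv]
  simpa using hs

end Converse

/-! ### Orders of elements in the class `𝒢₄` -/

variable [Fintype G] in
/-- For `x ≠ x⁻¹` of order `n`, the number `2 cos (2π / n)` is an eigenvalue of `Cay(G, {x, x⁻¹})`,
and it is an integer only for `n = 1, 2, 3, 4, 6`. -/
theorem MemClassG.pow_four_or_pow_six (hG : MemClassG 4 G) (x : G) : x ^ 4 = 1 ∨ x ^ 6 = 1 := by
  classical
  by_cases hx : x = x⁻¹
  · left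
    have : x * x = 1 := by nth_rw 2 [hx]; simp
    calc x ^ 4 = (x * x) * (x * x) := by rw [← pow_two, ← pow_two, ← pow_mul]
      _ = 1 := by rw [this, one_mul]
  have hT := hG.hasIntegerEigenvalues {x, x⁻¹} (by simp)
    (by simp only [Finset.mem_insert, Finset.mem_singleton, not_or]
        constructor <;> intro h
        · exact hx (by rw [← h, inv_one])
        · exact hx (by rw [inv_eq_one.mp h.symm, inv_one]))
    (Finset.card_le_two.trans (by norm_num))
  rw [Finset.sum_pair hx] at hT
  set n := orderOf x with hn
  have hn0 : n ≠ 0 := (orderOf_pos x).ne'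
  set ζ : ℂ := Complex.exp (2 * Real.pi * Complex.I / n)
  have hζ : IsPrimitiveRoot ζ n := Complex.isPrimitiveRoot_exp n hn0
  have hζ0 : ζ ≠ 0 := hζ.ne_zero hn0
  set δ : G → ℂ := Pi.single 1 1
  -- An eigenvector of `ρ x` for `ζ`: `n` times the projection of `δ` to that eigenspace.
  set v : G → ℂ := ∑ k ∈ Finset.range n, (ζ⁻¹ ^ k) • leftTranslation G (x ^ k) δ with hv
  have hv1 : v 1 = 1 := by
    rw [hv, Finset.sum_apply, Finset.sum_eq_single 0]
    · simp [δ]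
    · intro k hk hk0
      rw [Pi.smul_apply, leftTranslation_single_apply_one, if_neg, smul_zero]
      intro h
      exact hk0 (Nat.eq_zero_of_dvd_of_lt (orderOf_dvd_of_pow_eq_one h) (Finset.mem_range.mp hk))
    · intro h
      exact absurd (Finset.mem_range.mpr (Nat.pos_of_ne_zero hn0)) h
  have hv0 : v ≠ 0 := fun h => by simp [h] at hv1
  have hxv : leftTranslation G x v = ζ • v := by
    rw [hv, map_sum, Finset.smul_sum]
    have h1 : ∀ k, leftTranslation G x ((ζ⁻¹ ^ k) • leftTranslation G (x ^ k) δ) =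
        ζ • ((ζ⁻¹ ^ (k + 1)) • leftTranslation G (x ^ (k + 1)) δ) := fun k => by
      rw [map_smul, ← Module.End.mul_apply, ← map_mul, ← pow_succ', smul_smul, pow_succ' ζ⁻¹,
        mul_inv_cancel_left₀ hζ0]
    simp_rw [h1]
    rw [← Finset.smul_sum, ← Finset.smul_sum]
    congr 1
    have h2 := Finset.sum_range_succ (fun k => (ζ⁻¹ ^ k) • leftTranslation G (x ^ k) δ) n
    rw [Finset.sum_range_succ'] at h2
    rw [inv_pow ζ n, hζ.pow_eq_one, hn, pow_orderOf_eq_one, pow_zero, pow_zero, inv_one] at h2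
    exact add_right_cancel h2
  have hxv' : leftTranslation G x⁻¹ v = ζ⁻¹ • v := by
    have h : v = ζ⁻¹ • leftTranslation G x v := by
      rw [hxv, smul_smul, inv_mul_cancel₀ hζ0, one_smul]
    nth_rw 1 [h]
    rw [map_smul, ← Module.End.mul_apply, ← map_mul, inv_mul_cancel, map_one, Module.End.one_apply]
  obtain ⟨m, hm⟩ := hT.exists_int (μ := ζ + ζ⁻¹) hv0
    (by rw [LinearMap.add_apply, hxv, hxv', add_smul])
  have hnorm : ‖ζ‖ = 1 := hζ.norm'_eq_one hn0
  have hm2 : |m| ≤ 2 := by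
    have : ‖((m : ℤ) : ℂ)‖ ≤ 2 := by
      rw [← hm]
      refine (norm_add_le _ _).trans ?_
      rw [norm_inv, hnorm]; norm_num
    rw [Complex.norm_intCast] at this
    exact_mod_cast this
  have hq : ζ ^ 2 = m * ζ - 1 := by
    rw [← hm]; field_simp; ring
  have hroot : ζ ^ 4 = 1 ∨ ζ ^ 6 = 1 := by
    have h4 : ζ ^ 4 = (m * ζ - 1) ^ 2 := by rw [← hq]; ring
    have h6 : ζ ^ 6 = (m * ζ - 1) ^ 3 := by rw [← hq]; ring
    rw [h4, h6]
    obtain ⟨hl, hr⟩ := abs_le.mp hm2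
    interval_cases m <;> push_cast at hq ⊢
    · right; have : (ζ + 1) ^ 2 = 0 := by linear_combination hq
      have : ζ = -1 := by linear_combination pow_eq_zero_iff (two_ne_zero) |>.mp this
      rw [this]; norm_num
    · right; linear_combination (-ζ - 2) * hq
    · left; ring
    · right; linear_combination (ζ - 2) * hq
    · right; have : (ζ - 1) ^ 2 = 0 := by linear_combination hq
      have : ζ = 1 := by linear_combination pow_eq_zero_iff (two_ne_zero) |>.mp this
      rw [this]; norm_num
  -- `ζ` is a primitive root of order `n`, so the exponent found for `ζ` is a multiple of `n`.
  rcases hroot with h | h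
  · exact Or.inl (orderOf_dvd_iff_pow_eq_one.mp (hζ.dvd_of_pow_eq_one _ h))
  · exact Or.inr (orderOf_dvd_iff_pow_eq_one.mp (hζ.dvd_of_pow_eq_one _ h))

/-! ### Groups of exponent four in the class `𝒢₄` -/

theorem sum_insert_insert_pair {M : Type*} [AddCommMonoid M] [DecidableEq G] (f : G → M) {x y : G}
    (hx : x ≠ x⁻¹) (hy : y ≠ y⁻¹) (hxy : ¬ Commute x y) :
    ∑ s ∈ {x, x⁻¹, y, y⁻¹}, f s = f x + f x⁻¹ + f y + f y⁻¹ := by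
  have h1 : x ≠ y := by rintro rfl; exact hxy (Commute.refl _)
  have h2 : x ≠ y⁻¹ := by rintro rfl; exact hxy (Commute.inv_left (Commute.refl _))
  have h3 : x⁻¹ ≠ y := by rintro rfl; exact hxy (Commute.inv_right (Commute.refl _))
  have h4 : x⁻¹ ≠ y⁻¹ := fun h => h1 (inv_injective h)
  rw [Finset.sum_insert (by simp [hx, h1, h2]), Finset.sum_insert (by simp [h3, h1]),
    Finset.sum_pair hy, add_assoc, add_assoc]

variable [Fintype G]

theorem MemClassG.hasIntegerEigenvalues_pair (hG : MemClassG 4 G) {x y : G}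
    (hx : x ≠ x⁻¹) (hy : y ≠ y⁻¹) (hxy : ¬ Commute x y) :
    HasIntegerEigenvalues (leftTranslation G x + leftTranslation G x⁻¹ + leftTranslation G y +
      leftTranslation G y⁻¹) := by
  classical
  rw [← sum_insert_insert_pair (leftTranslation G) hx hy hxy]
  refine hG.hasIntegerEigenvalues _ ?_ ?_ Finset.card_le_four
  · simp only [Finset.mem_insert, Finset.mem_singleton]
    rintro s (rfl | rfl | rfl | rfl) <;> simp
  · simp only [Finset.mem_insert, Finset.mem_singleton, not_or]
    refine ⟨?_, ?_, ?_, ?_⟩ <;> intro h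
    · exact hx (by rw [← h, inv_one])
    · exact hx (by rw [inv_eq_one.mp h.symm, inv_one])
    · exact hy (by rw [← h, inv_one])
    · exact hy (by rw [inv_eq_one.mp h.symm, inv_one])

theorem MemClassG.commute_of_involutions (hG : MemClassG 4 G) {a b : G} (ha : a * a = 1)
    (hb : b * b = 1) (hab : (a * b) ^ 4 = 1) : Commute a b := by
  classical
  by_contra hcomm
  have hainv : a⁻¹ = a := inv_eq_of_mul_eq_one_right ha
  have hbinv : b⁻¹ = b := inv_eq_of_mul_eq_one_right hb
  have hne : a ≠ b := by rintro rfl; exact hcomm (Commute.refl _)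
  have hT := hG.hasIntegerEigenvalues {a, b} (by simp [hainv, hbinv])
    (by simp only [Finset.mem_insert, Finset.mem_singleton, not_or]
        constructor <;> rintro rfl
        · exact hcomm (Commute.one_left _)
        · exact hcomm (Commute.one_right _))
    (Finset.card_le_two.trans (by norm_num))
  rw [Finset.sum_pair hne] at hT
  set ρ := leftTranslation G
  have key := sq_add_mul_of_involutions (A := ρ a) (B := ρ b) (by rw [← map_mul, ha, map_one])
    (by rw [← map_mul, hb, map_one]) (by rw [← map_mul, ← map_pow, hab, map_one])
  set δ : G → ℂ := Pi.single 1 1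
  have hc2 : (a * b) ^ 2 ≠ 1 := fun h => hcomm <| by
    rw [pow_two, mul_eq_one_iff_eq_inv, mul_inv_rev, hainv, hbinv] at h
    exact h
  have := hT.isSquare_of_sq_mul 0 2 (v := δ) (by simpa using key) (fun h => by
      have h1 := congrFun h 1
      rw [← map_mul, ← map_pow, LinearMap.sub_apply, Module.End.one_apply, Pi.sub_apply,
        leftTranslation_single_apply_one, if_neg hc2] at h1
      simp [δ] at h1)
  norm_num at this

/-- In exponent `4`, involutions are central. If `z` denotes the commutator of `b` and the
involution `a`, then `z` is a central involution of the subgroup generated by `a` and `b`. The case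
`z = b ^ 2` is a dihedral group, with non-commuting involutions `a` and `a * b`; otherwise
`S = {a, b, b⁻¹}` gives the eigenvalue `√5` or `-√5`. -/
theorem MemClassG.commute_of_mul_self_eq_one (hG : MemClassG 4 G) (hexp : ∀ x : G, x ^ 4 = 1)
    {a : G} (ha : a * a = 1) (b : G) : Commute a b := by
  classical
  by_contra hcomm
  have hinvo : ∀ {c d : G}, c * c = 1 → d * d = 1 → Commute c d := fun hc hd =>
    hG.commute_of_involutions hc hd (hexp _)
  have hainv : a⁻¹ = a := inv_eq_of_mul_eq_one_right ha
  have hb2 : b * b ≠ 1 := fun hb => hcomm (hinvo ha hb)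
  have hbb : b * b * (b * b) = 1 := by
    rw [← pow_two, ← pow_two, ← pow_mul, hexp]
  have hbne : b ≠ b⁻¹ := fun h => hb2 (by nth_rw 2 [h]; simp)
  set a' := b * a * b⁻¹ with ha'
  have ha'2 : a' * a' = 1 := by
    calc a' * a' = b * (a * a) * b⁻¹ := by rw [ha']; group
      _ = 1 := by rw [ha]; group
  have haa' : a * a' = a' * a := hinvo ha ha'2
  have habb : a * (b * b) = b * b * a := hinvo ha hbb
  have hba' : b * a' * b⁻¹ = a := by
    calc b * a' * b⁻¹ = b * b * a * (b * b)⁻¹ := by rw [ha']; group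
      _ = a := by rw [← habb]; group
  obtain ⟨z, hz⟩ : ∃ z, z = a' * a := ⟨_, rfl⟩
  have hzz : z * z = 1 := by
    calc z * z = a' * (a * a') * a := by rw [hz]; group
      _ = (a' * a') * (a * a) := by rw [haa']; group
      _ = 1 := by rw [ha, ha'2, one_mul]
  have hza : a * z = z * a := by
    rw [hz, ← mul_assoc, haa', mul_assoc]
  have hzb : b * z = z * b := by
    calc b * z = (b * a' * b⁻¹) * (b * a * b⁻¹) * b := by rw [hz]; group
      _ = z * b := by rw [hba', ← ha', haa', hz]
  have hba : b * a = z * (a * b) := by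
    calc b * a = a' * b := by rw [ha']; group
      _ = a' * (a * a) * b := by rw [ha, mul_one]
      _ = z * (a * b) := by rw [hz]; group
  have hz1 : z ≠ 1 := fun h => hcomm (by rw [commute_iff_eq, hba, h, one_mul])
  have hzb2 : z * (b * b) ≠ 1 := by
    intro h
    have hab2 : (a * b) * (a * b) = 1 := by
      calc (a * b) * (a * b) = a * (b * a) * b := by group
        _ = (a * z) * a * (b * b) := by rw [hba]; group
        _ = z * (a * a) * (b * b) := by rw [hza]; group
        _ = 1 := by rw [ha, mul_one, h]
    have h1 := hinvo ha hab2
    refine hcomm ?_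
    have := (Commute.inv_right (Commute.refl a)).mul_right h1
    rwa [inv_mul_cancel_left] at this
  have ha1 : a ≠ 1 := by rintro rfl; exact hcomm (Commute.one_left _)
  have hb1 : b ≠ 1 := by rintro rfl; exact hcomm (Commute.one_right _)
  have hab : a ≠ b := by rintro rfl; exact hcomm (Commute.refl _)
  have hab' : a ≠ b⁻¹ := fun h => hab (by rw [← hainv, h, inv_inv])
  have hT := hG.hasIntegerEigenvalues {a, b, b⁻¹} (by simp [hainv])
    (by simp [ha1.symm, hb1.symm, hb1]) (Finset.card_le_three.trans (by norm_num))
  rw [Finset.sum_insert (by simp [hab, hab']), Finset.sum_pair hbne, ← add_assoc] at hT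
  have hbinv : b⁻¹ = b ^ 3 := inv_eq_of_mul_eq_one_right (by rw [← pow_succ', hexp])
  set ρ := leftTranslation G
  have key := sq_add_mul_of_anticommute_five (A := ρ a) (B := ρ b) (Z := ρ z)
    (by rw [← map_mul, ha, map_one]) (by rw [← map_pow, hexp, map_one])
    (by rw [← map_mul, hzz, map_one]) (by simp only [← map_mul, hza])
    (by simp only [← map_mul, hzb]) (by simp only [← map_mul, hba])
  rw [hbinv, map_pow] at hT
  set δ : G → ℂ := Pi.single 1 1 with hδ
  have := hT.isSquare_of_sq_mul 0 5 (v := δ) (by simpa using key) (fun h => by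
      have h1 := congrFun h 1
      simp only [pow_two, mul_add, sub_mul, one_mul, mul_one, ← map_mul, LinearMap.add_apply,
        LinearMap.sub_apply, Pi.add_apply, Pi.sub_apply, Module.End.one_apply, hδ, ρ,
        leftTranslation_single_apply_one, Pi.zero_apply, if_neg hb2, if_neg hz1, if_neg hzb2,
        Pi.single_eq_same] at h1
      norm_num at h1)
  norm_num at this

/-- If `z`, the commutator of `y` and `x`, is a central involution not in the group generated by
`x ^ 2` and `y ^ 2`, then `S = {x, x⁻¹, y, y⁻¹}` gives the eigenvalue `√8` or `-√8`. The conclusion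
says that `z` is in that group, as all elements involved are involutions. -/
theorem MemClassG.mem_klein_of_commutator (hG : MemClassG 4 G) {x y z : G}
    (hx4 : x ^ 4 = 1) (hy4 : y ^ 4 = 1) (hx : x * x ≠ 1) (hy : y * y ≠ 1) (hzz : z * z = 1)
    (hzx : x * z = z * x) (hzy : y * z = z * y) (hyx : y * x = z * (x * y)) :
    z = 1 ∨ z * (x * x) = 1 ∨ z * (y * y) = 1 ∨ z * (x * x * (y * y)) = 1 := by
  classical
  by_contra! hcon
  obtain ⟨h1, h2, h3, h4⟩ := hcon
  have hT := hG.hasIntegerEigenvalues_pair (x := x) (y := y)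
    (fun h => hx (by nth_rw 2 [h]; simp)) (fun h => hy (by nth_rw 2 [h]; simp))
    (fun h => h1 (by rw [h.eq] at hyx; simpa using hyx))
  have hxinv : x⁻¹ = x ^ 3 := inv_eq_of_mul_eq_one_right (by rw [← pow_succ', hx4])
  have hyinv : y⁻¹ = y ^ 3 := inv_eq_of_mul_eq_one_right (by rw [← pow_succ', hy4])
  rw [hxinv, hyinv, map_pow, map_pow] at hT
  set ρ := leftTranslation G
  have key := sq_add_mul_of_anticommute_eight (X := ρ x) (Y := ρ y) (Z := ρ z)
    (by rw [← map_pow, hx4, map_one]) (by rw [← map_pow, hy4, map_one])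
    (by rw [← map_mul, hzz, map_one]) (by simp only [← map_mul, hzx])
    (by simp only [← map_mul, hzy]) (by simp only [← map_mul, hyx])
  set δ : G → ℂ := Pi.single 1 1 with hδ
  have := hT.isSquare_of_sq_mul 0 8 (v := δ) (by simpa using key) (fun h => by
      have h0 := congrFun h 1
      simp only [pow_two, mul_add, add_mul, sub_mul, one_mul, mul_one, ← map_mul,
        LinearMap.add_apply, LinearMap.sub_apply, Pi.add_apply, Pi.sub_apply,
        Module.End.one_apply, hδ, ρ, leftTranslation_single_apply_one, Pi.zero_apply,
        if_neg h1, if_neg h2, if_neg h3, if_neg h4, if_neg hx, if_neg hy,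
        Pi.single_eq_same] at h0
      split_ifs at h0 <;> norm_num at h0)
  norm_num at this

/-- In exponent `4`, every conjugate of `x` is `x` or `x⁻¹`. As involutions are central, the
commutator `z` of `y` and `x` is a product of squares, so a central involution, and it lies in the
group generated by `x ^ 2` and `y ^ 2`. The claim is that `z = 1` or `z = x ^ 2`. -/
theorem MemClassG.conj_eq_of_exponent_four (hG : MemClassG 4 G) (hexp : ∀ x : G, x ^ 4 = 1)
    (y x : G) : y * x = x * y ∨ y * x = x⁻¹ * y := by
  have hcen : ∀ {a : G}, a * a = 1 → ∀ b, Commute a b := fun ha b =>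
    hG.commute_of_mul_self_eq_one hexp ha b
  have hsq : ∀ g : G, (g * g) * (g * g) = 1 := fun g => by
    rw [← pow_two, ← pow_two, ← pow_mul, hexp]
  by_cases hx : x * x = 1
  · exact Or.inl (hcen hx y).eq.symm
  by_cases hy : y * y = 1
  · exact Or.inl (hcen hy x).eq
  have cx := hcen (hsq x)
  have cy := hcen (hsq y)
  have cyx := hcen (hsq (y * x))
  -- The commutator of `y` and `x`, up to inverses of squares, which are their own inverses.
  obtain ⟨z, hz⟩ : ∃ z, z = (y * x) * (y * x) * ((y * y) * (x * x)) := ⟨_, rfl⟩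
  have hzc : ∀ g, g * z = z * g := fun g => by
    rw [hz]; exact (((cyx g).mul_left ((cy g).mul_left (cx g))).eq).symm
  have hzz : z * z = 1 := by
    have e : Commute ((y * x) * (y * x)) ((y * y) * (x * x)) := cyx _
    have e2 : Commute (y * y) (x * x) := cy _
    rw [hz, e.symm.mul_mul_mul_comm, hsq, one_mul, e2.symm.mul_mul_mul_comm, hsq, hsq, one_mul]
  have hyx : y * x = z * (x * y) := by
    have h1 : y * y * (x * x) * (x * y) = x⁻¹ * y⁻¹ := by
      have hx3 : x * x * x = x⁻¹ := by
        rw [eq_inv_iff_mul_eq_one, mul_assoc]; exact hsq x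
      have hy3 : y * y * y = y⁻¹ := by
        rw [eq_inv_iff_mul_eq_one, mul_assoc]; exact hsq y
      calc y * y * (x * x) * (x * y) = y * y * (x * x * x) * y := by group
        _ = (x * x * x) * (y * y * y) := by rw [(cy (x * x * x)).eq, mul_assoc (x * x * x)]
        _ = _ := by rw [hx3, hy3]
    rw [hz, mul_assoc, h1]; group
  have fin2 : z * (x * x) = 1 → y * x = x⁻¹ * y := fun h => by
    rw [hyx, ← mul_assoc]; congr 1
    rw [eq_inv_iff_mul_eq_one, mul_assoc, h]
  rcases hG.mem_klein_of_commutator (hexp x) (hexp y) hx hy hzz (hzc x) (hzc y) hyx with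
    h | h | h | h
  · left; rw [hyx, h, one_mul]
  · exact Or.inr (fin2 h)
  -- Here `z = y ^ 2`, and `(x * y) ^ 2 = x ^ 2`; so replacing `y` by `x * y`, which has the same
  -- commutator with `x`, puts `z` into the group generated by `x ^ 2`.
  · have hxy2 : (x * y) * (x * y) = x * x := by
      calc (x * y) * (x * y) = x * (y * x) * y := by group
        _ = (x * z) * (x * (y * y)) := by rw [hyx]; group
        _ = z * (x * (x * (y * y))) := by rw [hzc x]; group
        _ = z * ((y * y) * (x * x)) := by rw [← mul_assoc x x, (cy (x * x)).eq]
        _ = x * x := by rw [← mul_assoc, h, one_mul]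
    rcases hG.mem_klein_of_commutator (x := x) (y := x * y) (z := z) (hexp x) (hexp _) hx
      (by rwa [hxy2]) hzz (hzc x) (hzc _)
      (by rw [mul_assoc, hyx, ← mul_assoc x z, hzc x, mul_assoc]) with h | h | h | h
    · left; rw [hyx, h, one_mul]
    · exact Or.inr (fin2 h)
    · exact Or.inr (fin2 (by rwa [hxy2] at h))
    · left; rw [hxy2, hsq, mul_one] at h; rw [hyx, h, one_mul]
  -- Here `z = x ^ 2 * y ^ 2`, and `x * y` is an involution, hence central.
  · have hxy2 : (x * y) * (x * y) = 1 := by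
      calc (x * y) * (x * y) = x * (y * x) * y := by group
        _ = (x * z) * (x * (y * y)) := by rw [hyx]; group
        _ = z * (x * x * (y * y)) := by rw [hzc x]; group
        _ = 1 := h
    left
    have h1 := (hcen hxy2 x).eq
    exact mul_left_cancel (a := x) (by rw [← mul_assoc, h1])

end

/-! ### Commutators and nilpotent groups -/

section
variable {G : Type*} [Group G]

theorem pow_mul_eq_mul_pow_of_commutator {x y z : G} (hz : ∀ g, Commute z g)
    (h : y * x = z * (x * y)) (n : ℕ) : y ^ n * x = z ^ n * (x * y ^ n) := by
  induction n with
  | zero => simp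
  | succ n ih =>
    calc y ^ (n + 1) * x = y ^ n * (y * x) := by rw [pow_succ, mul_assoc]
      _ = y ^ n * z * (x * y) := by rw [h, mul_assoc]
      _ = z * (y ^ n * x) * y := by rw [← (hz (y ^ n)).eq]; group
      _ = z ^ (n + 1) * (x * y ^ (n + 1)) := by rw [ih, pow_succ', pow_succ]; group

theorem pow_mul_pow_of_commutator {x y z : G} (hz : ∀ g, Commute z g)
    (h : y * x = z * (x * y)) (m n : ℕ) : y ^ n * x ^ m = z ^ (n * m) * (x ^ m * y ^ n) := by
  have h1 : x * y ^ n = (z ^ n)⁻¹ * (y ^ n * x) := by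
    rw [eq_inv_mul_iff_mul_eq, pow_mul_eq_mul_pow_of_commutator hz h n]
  have h2 := pow_mul_eq_mul_pow_of_commutator
    (fun g => ((hz g).pow_left n).inv_left) h1 m
  rw [h2, inv_pow, ← pow_mul, mul_inv_cancel_left]

theorem commute_of_pow_prime_pow_eq_one [Finite G] [Group.IsNilpotent G] {p q k l : ℕ}
    [Fact p.Prime] [Fact q.Prime] (hpq : p ≠ q) {u t : G} (hu : u ^ p ^ k = 1)
    (ht : t ^ q ^ l = 1) : Commute u t := by
  have hP : ∀ {r j : ℕ} {g : G}, g ^ r ^ j = 1 → IsPGroup r (Subgroup.zpowers g) := by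
    rintro r j g hg ⟨_, m, rfl⟩
    refine ⟨j, Subtype.ext ?_⟩
    change (g ^ m) ^ r ^ j = 1
    rw [← zpow_natCast, zpow_comm, zpow_natCast, hg, one_zpow]
  obtain ⟨P, hP'⟩ := (hP hu).exists_le_sylow
  obtain ⟨Q, hQ'⟩ := (hP ht).exists_le_sylow
  exact Subgroup.commute_of_normal_of_disjoint P.1 Q.1
    (inferInstanceAs P.Normal) (inferInstanceAs Q.Normal)
    (IsPGroup.disjoint_of_ne p q hpq _ _ P.2 Q.2) u t
    (hP' (Subgroup.mem_zpowers u)) (hQ' (Subgroup.mem_zpowers t))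

open scoped commutatorElement in
/-- A nilpotent group whose second centre is contained in its centre is abelian. -/
theorem commute_of_forall_commutator_mem_center [Group.IsNilpotent G]
    (h : ∀ x : G, (∀ y : G, ⁅x, y⁆ ∈ Subgroup.center G) → x ∈ Subgroup.center G) (x y : G) :
    Commute x y := by
  obtain ⟨n, hn⟩ := Group.IsNilpotent.nilpotent' (G := G)
  have hle : ∀ n, Subgroup.upperCentralSeries G n ≤ Subgroup.center G := by
    intro n
    induction n with
    | zero => simp
    | succ n ih =>
      exact fun x hx => h x fun y => ih (Subgroup.mem_upperCentralSeries_succ_iff.mp hx y)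
  have hx : x ∈ Subgroup.center G := hle n (hn ▸ Subgroup.mem_top x)
  exact (Subgroup.mem_center_iff.mp hx y).symm

variable [Fintype G]

/-- If `z ≠ 1`, then `x` and `y` generate a Heisenberg group of order `27`, and
`S = {x, x⁻¹, y, y⁻¹}` gives the eigenvalue `1 + √3` or `1 - √3`. -/
theorem MemClassG.commutator_eq_one_of_pow_three (hG : MemClassG 4 G) {x y z : G}
    (hx : x ^ 3 = 1) (hy : y ^ 3 = 1) (hz : z ^ 3 = 1) (hzx : x * z = z * x)
    (hzy : y * z = z * y) (hyx : y * x = z * (x * y)) : z = 1 := by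
  classical
  by_contra hz1
  have hncomm : ¬ Commute x y := fun h => hz1 (by rw [h.eq] at hyx; simpa using hyx)
  have hself : ∀ {g : G}, g ^ 3 = 1 → g * g = 1 → g = 1 := fun h3 h2 => by
    rwa [pow_succ, pow_two, h2, one_mul] at h3
  have hx1 : x ≠ 1 := by rintro rfl; exact hncomm (Commute.one_left _)
  have hy1 : y ≠ 1 := by rintro rfl; exact hncomm (Commute.one_right _)
  have hyy : y * y ≠ 1 := fun h => hy1 (hself hy h)
  have hT := hG.hasIntegerEigenvalues_pair (x := x) (y := y)
    (fun h => hx1 (hself hx (by nth_rw 2 [h]; simp)))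
    (fun h => hyy (by nth_rw 2 [h]; simp)) hncomm
  have hxinv : x⁻¹ = x ^ 2 := inv_eq_of_mul_eq_one_right (by rw [← pow_succ', hx])
  have hyinv : y⁻¹ = y ^ 2 := inv_eq_of_mul_eq_one_right (by rw [← pow_succ', hy])
  have hzy1 : z * y ≠ 1 := fun h => hncomm <| by
    rw [← inv_eq_of_mul_eq_one_right h]; exact Commute.inv_right hzx
  have hzy2 : z * (y * y) ≠ 1 := fun h => hncomm <| by
    have : z = y := by
      rw [mul_eq_one_iff_eq_inv.mp h, ← pow_two, ← hyinv, inv_inv]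
    rw [← this]; exact hzx
  rw [hxinv, hyinv, map_pow, map_pow] at hT
  set ρ := leftTranslation G
  have key := sq_sub_one_mul_of_heisenberg (X := ρ x) (Y := ρ y) (Z := ρ z)
    (by rw [← map_pow, hx, map_one]) (by rw [← map_pow, hy, map_one])
    (by rw [← map_pow, hz, map_one]) (by simp only [← map_mul, hzx])
    (by simp only [← map_mul, hzy]) (by simp only [← map_mul, hyx])
  set δ : G → ℂ := Pi.single 1 1 with hδ
  have := hT.isSquare_of_sq_mul 1 3 (v := δ) (by simpa using key) (fun h => by
      have h0 := congrFun h 1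
      simp only [pow_two, mul_add, sub_mul, one_mul, mul_one, ← map_mul,
        LinearMap.add_apply, LinearMap.sub_apply, Pi.add_apply, Pi.sub_apply,
        Module.End.one_apply, hδ, ρ, leftTranslation_single_apply_one, Pi.zero_apply,
        if_neg hz1, if_neg hy1, if_neg hyy, if_neg hzy1, if_neg hzy2, Pi.single_eq_same] at h0
      norm_num at h0)
  norm_num at this

open scoped commutatorElement in
/-- For `x` in the second centre, the commutator `z⁻¹` of `x` and `y` is central and
bimultiplicative: `x ^ 2`, `y ^ 2` have order dividing `3` and give `z ^ 4 = 1`; `x ^ 3`, `y ^ 3`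
are involutions and give `z ^ 9 = 1`. -/
theorem MemClassG.commute_of_pow_six [Group.IsNilpotent G] (hG : MemClassG 4 G)
    (hexp : ∀ x : G, x ^ 6 = 1) (x y : G) : Commute x y := by
  refine commute_of_forall_commutator_mem_center (fun x hx => ?_) x y
  refine Subgroup.mem_center_iff.mpr fun y => ?_
  obtain ⟨z, hz⟩ : ∃ z, z = ⁅x, y⁆⁻¹ := ⟨_, rfl⟩
  have hzc : ∀ g, Commute z g := fun g => by
    rw [hz]
    exact Commute.inv_left (Subgroup.mem_center_iff.mp (hx y) g).symm
  have hyx : y * x = z * (x * y) := by rw [hz, commutatorElement_def]; group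
  have h2 : z ^ (2 * 2) = 1 := hG.commutator_eq_one_of_pow_three (x := x ^ 2) (y := y ^ 2)
    (by rw [← pow_mul, hexp]) (by rw [← pow_mul, hexp])
    (by rw [← pow_mul, show 2 * 2 * 3 = 6 * 2 from rfl, pow_mul, hexp, one_pow])
    ((hzc _).pow_left _).eq.symm ((hzc _).pow_left _).eq.symm
    (pow_mul_pow_of_commutator hzc hyx 2 2)
  have h3 : z ^ (3 * 3) = 1 := by
    have hba := pow_mul_pow_of_commutator hzc hyx 3 3
    have hw : ∀ g, Commute (z ^ (3 * 3)) g := fun g => (hzc g).pow_left _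
    have ha : x ^ 3 * x ^ 3 = 1 := by rw [← pow_add, hexp]
    have hb : y ^ 3 * y ^ 3 = 1 := by rw [← pow_add, hexp]
    have hab2 : (x ^ 3 * y ^ 3) ^ 2 = z ^ (3 * 3) := by
      calc (x ^ 3 * y ^ 3) ^ 2 = x ^ 3 * (y ^ 3 * x ^ 3) * y ^ 3 := by
            rw [pow_two]; simp only [mul_assoc]
        _ = x ^ 3 * z ^ (3 * 3) * x ^ 3 * (y ^ 3 * y ^ 3) := by
            rw [hba]; simp only [mul_assoc]
        _ = z ^ (3 * 3) := by rw [hb, mul_one, ← (hw (x ^ 3)).eq, mul_assoc, ha, mul_one]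
    have hab4 : (x ^ 3 * y ^ 3) ^ 4 = 1 := by
      rw [show 4 = 2 * 2 from rfl, pow_mul, hab2, ← pow_mul, show 3 * 3 * 2 = 6 * 3 from rfl,
        pow_mul, hexp, one_pow]
    have := hG.commute_of_involutions ha hb hab4
    rw [this.eq] at hba
    simpa using hba
  have hz1 : z = 1 := by
    rw [show 3 * 3 = 2 * 2 + 2 * 2 + 1 from rfl, pow_succ, pow_add, h2, one_mul, one_mul] at h3
    exact h3
  rw [hyx, hz1, one_mul]

end

/-! ### Nilpotent groups in the class `𝒢₄` -/

theorem lemma3p1 {G : Type*} [Group G] [Fintype G] [Group.IsNilpotent G]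
    (hG : MemClassG 4 G) : IsCayleyIntegral G := by
  have hpow := hG.pow_four_or_pow_six
  refine isCayleyIntegral_of_conj hpow ?_
  by_cases h4 : ∀ x : G, x ^ 4 = 1
  · exact hG.conj_eq_of_exponent_four h4
  · obtain ⟨t, ht⟩ := not_forall.mp h4
    have ht6 : t ^ 6 = 1 := (hpow t).resolve_left ht
    have h6 : ∀ x : G, x ^ 6 = 1 := fun u => by
      refine (hpow u).elim (fun hu => ?_) id
      -- If `u` had order `4`, then `u * t ^ 2` would have order `12`.
      have hcomm : Commute u (t ^ 2) :=
        commute_of_pow_prime_pow_eq_one (p := 2) (q := 3) (k := 2) (l := 1) (by norm_num)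
          (by rw [show 2 ^ 2 = 4 from rfl, hu]) (by rw [← pow_mul]; exact ht6)
      have h12 := hpow (u * t ^ 2)
      rw [hcomm.mul_pow, hcomm.mul_pow, hu, one_mul, ← pow_mul, ← pow_mul,
        show 2 * 4 = 6 + 2 from rfl, show 2 * 6 = 6 * 2 from rfl, pow_add, pow_mul t 6, ht6,
        one_pow, one_mul, mul_one] at h12
      exact h12.resolve_left fun h =>
        ht (by rw [show 4 = 2 * 2 from rfl, pow_mul, h, one_pow])
    exact fun g x => Or.inl (hG.commute_of_pow_six h6 g x).eq
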